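/- For a finite simple connected graph $G$ with shortest-path distance $d$, the magnitude $\#G\in\mathbb Q(q)$ is the sum of all entries of the inverse of the $V(G)\times V(G)$ matrix $\bigl(q^{d(x,y)}\bigr)_{x,y}$ over $\mathbb Q(q)$. For integers $k,l\ge 0$ let $MC_{k,l}(G)$ be the free abelian group on the tuples $(x_0,\dots,x_k)\in V(G)^{k+1}$ with $x_i\ne x_{i+1}$ for all $0\le i<k$ and length $\ell(x_0,\dots,x_k)=\sum_{i=0}^{k-1}d(x_i,x_{i+1})$ equal to $l$. Let $\partial: MC_{k,l}(G)\to MC_{k-1,l}(G)$ (for $k\ge 1$) be given by $\partial(x_0,\dots,x_k)=\sum_{i=1}^{k-1}(-1)^i\,\partial_i(x_0,\dots,x_k)$, where $\partial_i(x_0,\dots,x_k)=(x_0,\dots,\widehat{x_i},\dots,x_k)$ if omitting $x_i$ does not change the length, and $\partial_i(x_0,\dots,x_k)=0$ otherwise. The magnitude homology of $G$ is $MH_{k,l}(G)=H_k(MC_{*,l}(G))$. Let $\mathrm{Dod}$ be the dodecahedral graph and $\mathrm{Des}$ the Desargues graph, that is, the generalized Petersen graphs $GP(10,2)$ and $GP(10,3)$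 respectively, where $GP(10,m)$ has the vertices $u_i,v_i$ ($i\in\mathbb Z/10$) and the edges $u_iu_{i+1}$, $u_iv_i$, $v_iv_{i+m}$. Then $\mathrm{Dod}$ and $\mathrm{Des}$ have the same magnitude, $$\#\mathrm{Dod}=\#\mathrm{Des}=\frac{20}{1+3q+6q^2+6q^3+3q^4+q^5}\in\mathbb Q(q),$$ but different magnitude homology: it is not the case that $MH_{k,l}(\mathrm{Dod})\cong MH_{k,l}(\mathrm{Des})$ for all $k,l\ge 0$. More precisely, $MH_{2,4}(\mathrm{Dod})$ has nonzero rank (in particular it is nonzero), while $MH_{2,4}(\mathrm{Des})=0$. -/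

import Mathlib

noncomputable section

namespace SimpleGraph

variable {V : Type*}

section MagnitudeHomology

/-- The length `d(x₀,x₁) + ⋯ + d(x_{k-1},x_k)` of a tuple `(x₀, …, x_k)` of vertices, for the
shortest path distance of `G` (which is `⊤` between different connected components). -/
def tupleLength (G : SimpleGraph V) {k : ℕ} (x : Fin (k + 1) → V) : ℕ∞ :=
  ∑ i : Fin k, G.edist (x i.castSucc) (x i.succ)

/-- `(x₀, …, x_k)` is one of the basis elements in bidegree `(k, l)`: consecutive entries are
different and the length is `l`. -/
def IsMagnitudeTuple (G : SimpleGraph V) {k : ℕ} (l : ℕ) (x : Fin (k + 1) → V) : Prop :=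
  (∀ i : Fin k, x i.castSucc ≠ x i.succ) ∧ G.tupleLength x = l

/-- The magnitude chain group `MC_{k,l}(G)`: the free abelian group on the tuples
`(x₀, …, x_k)` of vertices with `x_i ≠ x_{i+1}` and of length `l`. -/
abbrev MagnitudeChain (G : SimpleGraph V) (k l : ℕ) : Type _ :=
  {x : Fin (k + 1) → V // G.IsMagnitudeTuple l x} →₀ ℤ

/-- The tuple `(x₀, …, x_{k+1})` with the entry `x_{i+1}` omitted, where `0 ≤ i < k`.
These are exactly the omissions of an entry that is neither the first nor the last one. -/
def omitInterior {k : ℕ} (x : Fin (k + 2) → V) (i : Fin k) : Fin (k + 1) → V :=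
  i.succ.castSucc.removeNth x

theorem succAbove_aux_castSucc {k : ℕ} (i : Fin (k + 1)) (m : Fin k) :
    i.succ.castSucc.succAbove (i.succAbove m).castSucc
      = (i.castSucc.succAbove (i.succAbove m)).castSucc := by
  ext
  simp only [Fin.succAbove, Fin.lt_def]
  split_ifs <;> simp_all <;> omega

theorem succAbove_aux_succ {k : ℕ} (i : Fin (k + 1)) (m : Fin k) :
    i.succ.castSucc.succAbove (i.succAbove m).succ
      = (i.castSucc.succAbove (i.succAbove m)).succ := by
  ext
  simp only [Fin.succAbove, Fin.lt_def]
  split_ifs <;> simp_all <;> omega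

theorem succAbove_aux_self_castSucc {k : ℕ} (i : Fin (k + 1)) :
    i.succ.castSucc.succAbove i.castSucc = i.castSucc.castSucc := by
  ext
  simp [Fin.succAbove, Fin.lt_def]

theorem succAbove_aux_self_succ {k : ℕ} (i : Fin (k + 1)) :
    i.succ.castSucc.succAbove i.succ = i.succ.succ := by
  ext
  simp only [Fin.succAbove, Fin.lt_def]
  split_ifs <;> simp_all

theorem tupleLength_split (G : SimpleGraph V) {k : ℕ} (x : Fin (k + 3) → V)
    (i : Fin (k + 1)) : ∃ s : ℕ∞,
    G.tupleLength x = G.edist (x i.castSucc.castSucc) (x i.succ.castSucc)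
      + (G.edist (x i.succ.castSucc) (x i.succ.succ) + s) ∧
    G.tupleLength (omitInterior x i) = G.edist (x i.castSucc.castSucc) (x i.succ.succ) + s := by
  refine ⟨∑ m : Fin k, G.edist (x (i.castSucc.succAbove (i.succAbove m)).castSucc)
    (x (i.castSucc.succAbove (i.succAbove m)).succ), ?_, ?_⟩
  · rw [tupleLength, Fin.sum_univ_succAbove _ i.castSucc, Fin.sum_univ_succAbove _ i]
    have e : i.castSucc.succAbove i = i.succ := Fin.succAbove_castSucc_self i
    rw [e, ← Fin.castSucc_succ]
  · rw [tupleLength, Fin.sum_univ_succAbove _ i]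
    simp only [omitInterior, Fin.removeNth, succAbove_aux_castSucc, succAbove_aux_succ,
      succAbove_aux_self_castSucc, succAbove_aux_self_succ]

/-- Omitting an interior entry does not increase the length. -/
theorem tupleLength_omitInterior_le (G : SimpleGraph V) {k : ℕ} (x : Fin (k + 2) → V)
    (i : Fin k) : G.tupleLength (omitInterior x i) ≤ G.tupleLength x := by
  cases k with
  | zero => exact i.elim0
  | succ k =>
    obtain ⟨s, h1, h2⟩ := G.tupleLength_split x i
    rw [h1, h2, ← add_assoc]
    gcongr
    exact G.edist_triangle

/-- If omitting an interior entry preserves the length, then consecutive entries of the new tuple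
are again different. -/
theorem IsMagnitudeTuple.omitInterior {G : SimpleGraph V} {k l : ℕ} {x : Fin (k + 2) → V}
    (hx : G.IsMagnitudeTuple l x) (i : Fin k)
    (h : G.tupleLength (omitInterior x i) = G.tupleLength x) :
    G.IsMagnitudeTuple l (omitInterior x i) := by
  refine ⟨?_, h.trans hx.2⟩
  cases k with
  | zero => exact i.elim0
  | succ k =>
    intro j
    rcases Fin.eq_self_or_eq_succAbove i j with rfl | ⟨m, rfl⟩
    · simp only [SimpleGraph.omitInterior, Fin.removeNth, succAbove_aux_self_castSucc,
        succAbove_aux_self_succ]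
      intro he
      obtain ⟨s, h1, h2⟩ := G.tupleLength_split x j
      have hl := hx.2
      rw [h1] at hl
      rw [h1, h2, he, edist_self, zero_add] at h
      have hs : s ≠ ⊤ := by
        rintro rfl
        simp at hl
      have h0 : G.edist (x j.castSucc.castSucc) (x j.succ.castSucc)
          + G.edist (x j.succ.castSucc) (x j.succ.succ) + s = 0 + s := by
        rw [add_assoc, zero_add, ← he] at *
        exact h.symm
      have h3 := ENat.add_left_injective_of_ne_top hs h0
      have h4 := (add_eq_zero.1 h3).1
      exact hx.1 j.castSucc (edist_eq_zero_iff.1 h4)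
    · simp only [SimpleGraph.omitInterior, Fin.removeNth, succAbove_aux_castSucc,
        succAbove_aux_succ]
      exact hx.1 _

open Classical in
/-- The face `∂_{i+1}` of a basis element: omit the interior entry `x_{i+1}` if this preserves
the length, and `0` otherwise. -/
def magnitudeFace (G : SimpleGraph V) {k l : ℕ}
    (x : {x : Fin (k + 2) → V // G.IsMagnitudeTuple l x}) (i : Fin k) : G.MagnitudeChain k l :=
  if h : G.tupleLength (omitInterior x.1 i) = G.tupleLength x.1 then
    Finsupp.single ⟨omitInterior x.1 i, x.2.omitInterior i h⟩ 1
  else 0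

/-- The differential `∂ : MC_{k+1,l}(G) → MC_{k,l}(G)`, the linear map with
`∂ (x₀, …, x_{k+1}) = ∑_{1 ≤ i ≤ k} (-1)^i ∂_i (x₀, …, x_{k+1})`. -/
def magnitudeDifferential (G : SimpleGraph V) (k l : ℕ) :
    G.MagnitudeChain (k + 1) l →ₗ[ℤ] G.MagnitudeChain k l :=
  Finsupp.linearCombination ℤ fun x =>
    ∑ i : Fin k, (-1 : ℤ) ^ ((i : ℕ) + 1) • G.magnitudeFace x i

open Classical in
def tupleOrZero (G : SimpleGraph V) {k : ℕ} (l : ℕ) (y : Fin (k + 1) → V) :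
    G.MagnitudeChain k l :=
  if h : G.IsMagnitudeTuple l y then Finsupp.single ⟨y, h⟩ 1 else 0

theorem magnitudeFace_eq (G : SimpleGraph V) {k l : ℕ}
    (x : {x : Fin (k + 2) → V // G.IsMagnitudeTuple l x}) (i : Fin k) :
    G.magnitudeFace x i = G.tupleOrZero l (omitInterior x.1 i) := by
  unfold magnitudeFace tupleOrZero
  by_cases h : G.tupleLength (omitInterior x.1 i) = G.tupleLength x.1
  · rw [dif_pos h, dif_pos (x.2.omitInterior i h)]
  · rw [dif_neg h, dif_neg]
    exact fun h' => h (h'.2.trans x.2.2.symm)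

theorem differential_face (G : SimpleGraph V) {k l : ℕ}
    (x : {x : Fin (k + 3) → V // G.IsMagnitudeTuple l x}) (i : Fin (k + 1)) :
    G.magnitudeDifferential k l (G.magnitudeFace x i)
      = ∑ j : Fin k, (-1 : ℤ) ^ ((j : ℕ) + 1) •
          G.tupleOrZero l (omitInterior (omitInterior x.1 i) j) := by
  by_cases h : G.tupleLength (omitInterior x.1 i) = G.tupleLength x.1
  · rw [magnitudeFace, dif_pos h, magnitudeDifferential, Finsupp.linearCombination_single,
      one_smul]
    simp only [magnitudeFace_eq]
  · rw [magnitudeFace, dif_neg h, map_zero]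
    refine (Finset.sum_eq_zero fun j _ => ?_).symm
    rw [tupleOrZero, dif_neg, smul_zero]
    intro h'
    refine h (le_antisymm (G.tupleLength_omitInterior_le _ _) ?_)
    rw [x.2.2, ← h'.2]
    exact G.tupleLength_omitInterior_le _ _

theorem omitInterior_comm {k : ℕ} (x : Fin (k + 3) → V) (i : Fin (k + 1)) (j : Fin k) :
    omitInterior (omitInterior x (i.succAbove j)) (j.predAbove i)
      = omitInterior (omitInterior x i) j := by
  funext m
  simp only [omitInterior, Fin.removeNth]
  have h1 : (i.succAbove j).succ.castSucc
      = i.succ.castSucc.succAbove j.succ.castSucc := by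
    rw [← Fin.succ_succAbove_succ, Fin.castSucc_succAbove_castSucc]
  have h2 : (j.predAbove i).succ.castSucc
      = j.succ.castSucc.predAbove i.succ.castSucc := by
    rw [← Fin.succ_predAbove_succ, Fin.castSucc_predAbove_castSucc]
  rw [h1, h2, Fin.succAbove_succAbove_succAbove_predAbove]

/-- The differential squares to zero. -/
theorem magnitudeDifferential_comp (G : SimpleGraph V) (k l : ℕ) :
    G.magnitudeDifferential k l ∘ₗ G.magnitudeDifferential (k + 1) l = 0 := by
  refine Finsupp.lhom_ext' fun x => LinearMap.ext_ring ?_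
  simp only [LinearMap.comp_apply, Finsupp.lsingle_apply, LinearMap.zero_apply]
  rw [magnitudeDifferential.eq_def G (k + 1), Finsupp.linearCombination_single, one_smul, map_sum]
  simp only [map_smul, differential_face, Finset.smul_sum, smul_smul]
  rw [← Finset.sum_product', Finset.univ_product_univ]
  refine Finset.sum_involution (fun p _ => (p.1.succAbove p.2, p.2.predAbove p.1)) ?_ ?_ ?_ ?_
  · rintro ⟨i, j⟩ -
    have h := Fin.neg_one_pow_succAbove_add_predAbove (R := ℤ) i j
    rw [omitInterior_comm, ← add_smul]
    convert zero_smul ℤ _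
    simp only [pow_succ, pow_add] at h ⊢
    linarith
  · rintro ⟨i, j⟩ - - h
    exact Fin.succAbove_ne i j (congrArg Prod.fst h)
  · exact fun _ _ => Finset.mem_univ _
  · rintro ⟨i, j⟩ -
    simp [Fin.succAbove_succAbove_predAbove, Fin.predAbove_predAbove_succAbove]

/-- The magnitude chain complex `MC_{*,l}(G)` of abelian groups. -/
def magnitudeComplex (G : SimpleGraph V) (l : ℕ) : ChainComplex (ModuleCat ℤ) ℕ :=
  ChainComplex.of (fun k => ModuleCat.of ℤ (G.MagnitudeChain k l))
    (fun k => ModuleCat.ofHom (G.magnitudeDifferential k l))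
    (fun k => by rw [← ModuleCat.ofHom_comp, magnitudeDifferential_comp]; rfl)

/-- The magnitude homology group `MH_{k,l}(G) = H_k(MC_{*,l}(G))`. -/
def magnitudeHomology (G : SimpleGraph V) (k l : ℕ) : ModuleCat ℤ :=
  (G.magnitudeComplex l).homology k

end MagnitudeHomology

section Magnitude

variable [Fintype V]

open Classical in
/-- The matrix with entries `q^{d(x,y)}` over the field `ℚ(q)` of rational functions, where
`q^∞ = 0` for vertices in different connected components. -/
def magnitudeMatrix (G : SimpleGraph V) : Matrix V V (RatFunc ℚ) :=
  Matrix.of fun x y => if G.Reachable x y then RatFunc.X ^ G.dist x y else 0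

open Classical in
/-- The magnitude of a finite graph, a rational function in `q`: the sum of all the entries of the
inverse of the matrix `(q^{d(x,y)})`. -/
def magnitude (G : SimpleGraph V) : RatFunc ℚ :=
  ∑ x, ∑ y, (G.magnitudeMatrix)⁻¹ x y

open Classical in
/-- The matrix `(q^{d(x,y)})` is always invertible. -/
theorem isUnit_det_magnitudeMatrix (G : SimpleGraph V) : IsUnit G.magnitudeMatrix.det := by
  let P : Matrix V V (Polynomial ℚ) :=
    Matrix.of fun x y => if G.Reachable x y then Polynomial.X ^ G.dist x y else 0
  have hP : G.magnitudeMatrix = P.map (algebraMap (Polynomial ℚ) (RatFunc ℚ)) := by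
    ext x y
    simp only [magnitudeMatrix, P, Matrix.of_apply, Matrix.map_apply]
    split_ifs <;> simp
  have h1 : P.map (Polynomial.evalRingHom 0) = 1 := by
    ext x y
    simp only [P, Matrix.of_apply, Matrix.map_apply, Matrix.one_apply]
    by_cases hxy : x = y
    · subst hxy
      simp
    · split_ifs with h
      · simp [(h.pos_dist_of_ne hxy).ne']
      · simp
  have h2 : P.det ≠ 0 := by
    intro h0
    have h3 := RingHom.map_det (Polynomial.evalRingHom (0 : ℚ)) P
    rw [RingHom.mapMatrix_apply, h1, h0] at h3
    simp at h3
  rw [hP, ← RingHom.mapMatrix_apply, ← RingHom.map_det, isUnit_iff_ne_zero]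
  exact fun h => h2 ((map_eq_zero_iff _ (RatFunc.algebraMap_injective ℚ)).1 h)

end Magnitude

/-- The generalized Petersen graph `GP(n, k)`: an outer cycle `u_i` (the left summand), an inner
part `v_i` (the right summand), `i ∈ ℤ/n`, with the edges
`u_i u_{i+1}`, `u_i v_i` and `v_i v_{i+k}`. -/
def generalizedPetersen (n k : ℕ) : SimpleGraph (ZMod n ⊕ ZMod n) :=
  SimpleGraph.fromRel fun a b =>
    match a, b with
    | .inl i, .inl j => j = i + 1
    | .inl i, .inr j => j = i
    | .inr i, .inr j => j = i + (k : ZMod n)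
    | .inr _, .inl _ => False

/-- The dodecahedral graph, the graph of vertices and edges of the regular dodecahedron, as the
generalized Petersen graph `GP(10, 2)`. -/
def dodecahedralGraph : SimpleGraph (ZMod 10 ⊕ ZMod 10) := generalizedPetersen 10 2

/-- The Desargues graph, as the generalized Petersen graph `GP(10, 3)`. -/
def desarguesGraph : SimpleGraph (ZMod 10 ⊕ ZMod 10) := generalizedPetersen 10 3

end SimpleGraph

end

/-! In both graphs every vertex sees 1, 3, 6, 6, 3, 1 vertices at distances 0, …, 5, so all row sums
of the matrix `q^d` agree and the magnitude is 20 divided by that sum.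

`MH_{2,4}` sees how geodesics fit together. Modulo boundaries, (x,w,z) = (x,y,z) whenever (x,w,y,z)
is a basis tuple of length 4, a triple of another length counting as 0. In Dod the points strictly
between u₀ and u₄ form two disjoint strands, and counting triples through one strand is a cocycle
that detects the difference of two triples, one through each strand
(`finrank_magnitudeHomology_two_ne_zero`). In Des every triple from x to z is congruent to one
standard triple if d(x,z) = 4 and to 0 otherwise, so a chain is determined modulo boundaries by its
differential, and cycles are boundaries (`isZero_magnitudeHomology_two_four`).

Facts about distances are finite checks on explicit tables, justified by
`edist_eq_of_lipschitz_of_descent`. -/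

namespace SimpleGraph

/-! ### Homology of the magnitude complex via cycles and boundaries -/

section Homology

open CategoryTheory

variable {V : Type*}

theorem magnitudeComplex_d (G : SimpleGraph V) (k l : ℕ) :
    (G.magnitudeComplex l).d (k + 1) k = ModuleCat.ofHom (G.magnitudeDifferential k l) :=
  ChainComplex.of_d (fun k => ModuleCat.of ℤ (G.MagnitudeChain k l))
    (fun k => ModuleCat.ofHom (G.magnitudeDifferential k l)) k

theorem isZero_magnitudeHomology (G : SimpleGraph V) (k l : ℕ)
    (h : ∀ c, G.magnitudeDifferential k l c = 0 →
      c ∈ LinearMap.range (G.magnitudeDifferential (k + 1) l)) :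
    Limits.IsZero (G.magnitudeHomology (k + 1) l) := by
  refine ((G.magnitudeComplex l).exactAt_iff_isZero_homology (k + 1)).1 ?_
  rw [(G.magnitudeComplex l).exactAt_iff' (k + 2) (k + 1) k (by simp) (by simp),
    ShortComplex.moduleCat_exact_iff]
  change ∀ c, (G.magnitudeComplex l).d (k + 1) k c = 0 →
    ∃ b, (G.magnitudeComplex l).d (k + 2) (k + 1) b = c
  rw [magnitudeComplex_d, magnitudeComplex_d]
  exact h

/-- If a multiple a • c with a ≠ 0 were a boundary, then a * φ c = 0. So c has a non-torsion class;
finiteness is what turns this into nonzero `finrank`. -/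
theorem _root_.CategoryTheory.ShortComplex.finrank_homology_ne_zero
    {R : Type*} [CommRing R] [IsDomain R] (S : ShortComplex (ModuleCat R)) [IsNoetherian R S.X₂]
    (φ : S.X₂ →ₗ[R] R)
    (hφ : ∀ b, φ (S.f.hom b) = 0) (c : S.X₂) (hc : S.g.hom c = 0) (hφc : φ c ≠ 0) :
    Module.finrank R S.homology ≠ 0 := by
  rw [S.moduleCatHomologyIso.toLinearEquiv.finrank_eq]
  have : Module.Finite R S.moduleCatLeftHomologyData.H :=
    inferInstanceAs (Module.Finite R (LinearMap.ker S.g.hom ⧸ LinearMap.range S.moduleCatToCycles))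
  rw [Ne, Module.finrank_eq_zero_iff]
  intro h
  obtain ⟨a, ha, h0⟩ := h (Submodule.Quotient.mk (⟨c, hc⟩ : LinearMap.ker S.g.hom))
  obtain ⟨b, hb⟩ := (Submodule.Quotient.mk_eq_zero (LinearMap.range S.moduleCatToCycles)
    (x := a • (⟨c, hc⟩ : LinearMap.ker S.g.hom))).1 h0
  have hb' : S.f.hom b = a • c := congrArg Subtype.val hb
  have hφb := hφ b
  rw [hb', map_smul, smul_eq_mul] at hφb
  exact mul_ne_zero ha hφc hφb

/-- A cycle on which some cocycle does not vanish forces the homology to have positive rank. -/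
theorem finrank_magnitudeHomology_ne_zero (G : SimpleGraph V) [Finite V] (k l : ℕ)
    (φ : G.MagnitudeChain (k + 1) l →ₗ[ℤ] ℤ)
    (hφ : ∀ b, φ (G.magnitudeDifferential (k + 1) l b) = 0) (c : G.MagnitudeChain (k + 1) l)
    (hc : G.magnitudeDifferential k l c = 0) (hφc : φ c ≠ 0) :
    Module.finrank ℤ (G.magnitudeHomology (k + 1) l) ≠ 0 := by
  let S := (G.magnitudeComplex l).sc' (k + 2) (k + 1) k
  have hf : S.f.hom = G.magnitudeDifferential (k + 1) l :=
    congrArg ModuleCat.Hom.hom (G.magnitudeComplex_d (k + 1) l)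
  have hg : S.g.hom = G.magnitudeDifferential k l :=
    congrArg ModuleCat.Hom.hom (G.magnitudeComplex_d k l)
  have hfin : Module.Finite ℤ (G.MagnitudeChain (k + 1) l) := inferInstance
  have : IsNoetherian ℤ S.X₂ := @isNoetherian_of_isNoetherianRing_of_finite ℤ _ _ _ _ _ hfin
  refine ((G.magnitudeComplex l).homologyIsoSc' (k + 2) (k + 1) k
    (by simp) (by simp)).toLinearEquiv.finrank_eq.trans_ne ?_
  exact S.finrank_homology_ne_zero φ (fun b => (congrArg φ (LinearMap.congr_fun hf b)).trans (hφ b))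
    c ((LinearMap.congr_fun hg c).trans hc) hφc

end Homology

/-! ### Certifying distances; magnitude from constant row sums -/

section Distance

variable {V : Type*}

/-- A function that is one-Lipschitz along the edges and can be decreased along some edge at each
positive value is the distance. -/
theorem edist_eq_of_lipschitz_of_descent (G : SimpleGraph V) (D : V → V → ℕ)
    (h0 : ∀ x y, D x y = 0 ↔ x = y) (hlip : ∀ x y z, G.Adj x y → D x z ≤ D y z + 1)
    (hdesc : ∀ x z, x ≠ z → ∃ y, G.Adj x y ∧ D y z + 1 = D x z) (x y : V) :
    G.edist x y = D x y := by
  apply le_antisymm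
  · suffices h : ∀ n x, D x y = n → ∃ p : G.Walk x y, p.length = n by
      obtain ⟨p, hp⟩ := h _ x rfl
      exact hp ▸ G.edist_le p
    intro n
    induction n with
    | zero =>
      intro x hx
      obtain rfl := (h0 x y).1 hx
      exact ⟨.nil, rfl⟩
    | succ n ih =>
      intro x hx
      obtain ⟨w, hw, hd⟩ := hdesc x y fun h => by simp [(h0 x y).2 h] at hx
      obtain ⟨p, hp⟩ := ih w (by omega)
      exact ⟨.cons hw p, by simp [hp]⟩
  · refine le_iInf fun p => ?_
    rw [Nat.cast_le]
    induction p with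
    | nil => exact ((h0 _ _).2 rfl).le
    | cons h p ih => exact (hlip _ _ _ h).trans (by simpa using ih)

/-- If all rows of the distance matrix sum to the same `c`, then the magnitude is `|V| / c`. -/
theorem magnitude_eq_of_sum_eq [Fintype V] (G : SimpleGraph V) (hG : G.Connected)
    (c : RatFunc ℚ) (hc : c ≠ 0) (h : ∀ x, ∑ y, RatFunc.X ^ G.dist x y = c) :
    G.magnitude = Fintype.card V / c := by
  classical
  have hu := G.isUnit_det_magnitudeMatrix
  -- The constant vector `c⁻¹` is a weighting, so it gives the row sums of the inverse matrix.
  have h1 : G.magnitudeMatrix.mulVec (fun _ => c⁻¹) = 1 := by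
    ext x
    simp only [Matrix.mulVec, dotProduct, magnitudeMatrix, Matrix.of_apply, ← Finset.sum_mul,
      hG x _, if_true, h x, Pi.one_apply]
    exact mul_inv_cancel₀ hc
  have h2 : G.magnitudeMatrix⁻¹.mulVec 1 = fun _ => c⁻¹ := by
    rw [← h1, Matrix.mulVec_mulVec, Matrix.nonsing_inv_mul _ (by convert hu), Matrix.one_mulVec]
  have h3 : ∀ x, ∑ y, G.magnitudeMatrix⁻¹ x y = c⁻¹ := fun x => by
    simpa [Matrix.mulVec, dotProduct] using congrFun h2 x
  unfold magnitude
  calc _ = ∑ x : V, c⁻¹ := Finset.sum_congr rfl fun x _ => by rw [← h3 x]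
    _ = _ := by simp [div_eq_mul_inv]

end Distance


/-! ### Distance tables of the two graphs -/

section GeneralizedPetersen

/-- The function on pairs of vertices of `GP(10, m)` that depends on the parts containing the two
vertices and on the difference of their indices, with values listed in `a` (both outer), `b`
(outer and inner) and `c` (both inner). -/
def tableDist (a b c : Fin 10 → ℕ) : ZMod 10 ⊕ ZMod 10 → ZMod 10 ⊕ ZMod 10 → ℕ
  | .inl i, .inl j => a (j - i)
  | .inl i, .inr j => b (j - i)
  | .inr i, .inl j => b (i - j)
  | .inr i, .inr j => c (j - i)

/-- The distance in the dodecahedral graph. -/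
def dodecahedralDist : ZMod 10 ⊕ ZMod 10 → ZMod 10 ⊕ ZMod 10 → ℕ :=
  tableDist ![0, 1, 2, 3, 4, 5, 4, 3, 2, 1] ![1, 2, 2, 3, 3, 4, 3, 3, 2, 2]
    ![0, 3, 1, 4, 2, 5, 2, 4, 1, 3]

/-- The distance in the Desargues graph. -/
def desarguesDist : ZMod 10 ⊕ ZMod 10 → ZMod 10 ⊕ ZMod 10 → ℕ :=
  tableDist ![0, 1, 2, 3, 4, 5, 4, 3, 2, 1] ![1, 2, 3, 2, 3, 4, 3, 2, 3, 2]
    ![0, 3, 4, 1, 2, 5, 2, 1, 4, 3]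

instance (n k : ℕ) : DecidableRel (generalizedPetersen n k).Adj
  | .inl i, .inl j => decidable_of_iff (i ≠ j ∧ (j = i + 1 ∨ i = j + 1))
      (by simp [generalizedPetersen])
  | .inl i, .inr j => decidable_of_iff (j = i) (by simp [generalizedPetersen])
  | .inr i, .inl j => decidable_of_iff (i = j) (by simp [generalizedPetersen])
  | .inr i, .inr j => decidable_of_iff (i ≠ j ∧ (j = i + (k : ZMod n) ∨ i = j + (k : ZMod n)))
      (by simp [generalizedPetersen])

theorem edist_dodecahedralGraph (x y : ZMod 10 ⊕ ZMod 10) :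
    dodecahedralGraph.edist x y = dodecahedralDist x y := by
  unfold dodecahedralGraph
  refine edist_eq_of_lipschitz_of_descent _ _ ?_ ?_ ?_ x y <;> clear x y <;> decide +kernel

theorem edist_desarguesGraph (x y : ZMod 10 ⊕ ZMod 10) :
    desarguesGraph.edist x y = desarguesDist x y := by
  unfold desarguesGraph
  refine edist_eq_of_lipschitz_of_descent _ _ ?_ ?_ ?_ x y <;> clear x y <;> decide +kernel

/-- View Des as the 2- and 3-subsets of {1,…,5} under inclusion. For x = 12, z = 34, take c = 134:
the eligible y are 123 and 124, both two steps from c. For x = 12, z = 13, take c = 123, which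
shares the neighbour x with every y. Complementation handles 3-subsets. -/
theorem exists_desarguesDist : ∀ x z, desarguesDist x z = 2 ∨ desarguesDist x z = 4 →
    ∃ c, desarguesDist c z = 1 ∧ desarguesDist x c + 1 = desarguesDist x z ∧
      ∀ y, desarguesDist x y = 1 → desarguesDist y z = 3 → desarguesDist y c = 2 := by
  decide +kernel

/-- The triangle inequality leaves 2, 3, 4, and 3 is excluded because Des is bipartite. -/
theorem desarguesDist_eq_two_or_four : ∀ x y z, desarguesDist x y = 1 → desarguesDist y z = 3 →
    desarguesDist x z = 2 ∨ desarguesDist x z = 4 := by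
  decide +kernel

end GeneralizedPetersen
-- Vanishing and non-vanishing criteria in degree two
section LowDegree

variable {V : Type*} {G : SimpleGraph V} {D : V → V → ℕ}

theorem single_eq_tupleOrZero {k l : ℕ} (p : {x : Fin (k + 1) → V // G.IsMagnitudeTuple l x}) :
    Finsupp.single p (1 : ℤ) = G.tupleOrZero l p.1 := by
  rw [tupleOrZero, dif_pos p.2]

theorem isMagnitudeTuple_two_iff (hD : ∀ x y, G.edist x y = D x y) {l : ℕ} {x z : V} :
    G.IsMagnitudeTuple l ![x, z] ↔ x ≠ z ∧ D x z = l := by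
  simp only [IsMagnitudeTuple, tupleLength, hD, Fin.forall_fin_succ, Fin.sum_univ_succ]
  simp

theorem isMagnitudeTuple_three_iff (hD : ∀ x y, G.edist x y = D x y) {l : ℕ} {x y z : V} :
    G.IsMagnitudeTuple l ![x, y, z] ↔ x ≠ y ∧ y ≠ z ∧ D x y + D y z = l := by
  simp only [IsMagnitudeTuple, tupleLength, hD, Fin.forall_fin_succ, Fin.sum_univ_succ]
  simp [and_assoc]
  norm_cast
  tauto

theorem isMagnitudeTuple_four_iff (hD : ∀ x y, G.edist x y = D x y) {l : ℕ} {x w y z : V} :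
    G.IsMagnitudeTuple l ![x, w, y, z] ↔
      x ≠ w ∧ w ≠ y ∧ y ≠ z ∧ D x w + D w y + D y z = l := by
  simp only [IsMagnitudeTuple, tupleLength, hD, Fin.forall_fin_succ, Fin.sum_univ_succ]
  simp [and_assoc, ← add_assoc]
  norm_cast
  tauto

/-- No case split is needed: `tupleOrZero` vanishes exactly when omitting y shortens the tuple. -/
theorem magnitudeDifferential_three {l : ℕ} {x y z : V} (h : G.IsMagnitudeTuple l ![x, y, z]) :
    G.magnitudeDifferential 1 l (G.tupleOrZero l ![x, y, z]) = -G.tupleOrZero l ![x, z] := by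
  have e : omitInterior ![x, y, z] 0 = ![x, z] := by ext i; fin_cases i <;> rfl
  rw [tupleOrZero, dif_pos h, magnitudeDifferential, Finsupp.linearCombination_single, one_smul]
  simp [magnitudeFace_eq, e]

theorem magnitudeDifferential_four {l : ℕ} {x w y z : V}
    (h : G.IsMagnitudeTuple l ![x, w, y, z]) :
    G.magnitudeDifferential 2 l (G.tupleOrZero l ![x, w, y, z]) =
      -G.tupleOrZero l ![x, y, z] + G.tupleOrZero l ![x, w, z] := by
  have e0 : omitInterior ![x, w, y, z] 0 = ![x, y, z] := by ext i; fin_cases i <;> rfl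
  have e1 : omitInterior ![x, w, y, z] 1 = ![x, w, z] := by ext i; fin_cases i <;> rfl
  rw [tupleOrZero, dif_pos h, magnitudeDifferential, Finsupp.linearCombination_single, one_smul]
  simp [magnitudeFace_eq, e0, e1, Fin.sum_univ_two]

/-- Vanishing of `MH_{2,4}` when geodesic intervals of length four are connected and short
intervals fill in the remaining triples. -/
theorem isZero_magnitudeHomology_two_four (hD : ∀ x y, G.edist x y = D x y)
    (hdesc : ∀ x z, x ≠ z → ∃ y, D x y = 1 ∧ D y z + 1 = D x z)
    (heven : ∀ x y z, D x y = 1 → D y z = 3 → D x z = 2 ∨ D x z = 4)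
    (hex : ∀ x z, D x z = 2 ∨ D x z = 4 → ∃ c, D c z = 1 ∧ D x c + 1 = D x z ∧
      ∀ y, D x y = 1 → D y z = 3 → D y c = 2) :
    CategoryTheory.Limits.IsZero (G.magnitudeHomology 2 4) := by
  classical
  have h0 : ∀ {x y}, D x y ≠ 0 → x ≠ y := by
    rintro x _ h rfl
    have := hD x x
    rw [edist_self] at this
    exact h (by exact_mod_cast this.symm)
  have h0' : ∀ {x y}, x ≠ y → D x y ≠ 0 := fun {x y} hne h => by
    have := hD x y
    rw [h] at this
    exact hne (edist_eq_zero_iff.1 (by exact_mod_cast this))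
  have htri : ∀ x y z, D x z ≤ D x y + D y z := fun x y z => by
    have := G.edist_triangle (u := x) (v := y) (w := z)
    simp only [hD] at this
    exact_mod_cast this
  choose! c hc1 hc2 hc3 using hex
  let R := LinearMap.range (G.magnitudeDifferential 2 4)
  let T : V → V → V → G.MagnitudeChain 2 4 := fun x y z => G.tupleOrZero 4 ![x, y, z]
  have hT : ∀ {x y z}, D x y + D y z ≠ 4 → T x y z = 0 := fun h => dif_neg fun h' =>
    h ((isMagnitudeTuple_three_iff hD).1 h').2.2
  -- The standard representative, modulo boundaries, of all triples from x to z.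
  let K : V → V → G.MagnitudeChain 2 4 := fun x z => if D x z = 4 then T x (c x z) z else 0
  have near : ∀ {x y z}, D x y = 1 → D y z = 3 → T x y z - K x z ∈ R := by
    intro x y z hxy hyz
    have hxz := heven x y z hxy hyz
    have e1 := hc1 x z hxz
    have e2 := hc2 x z hxz
    have e3 := hc3 x z hxz y hxy hyz
    -- The step lengths are 1, 2, 1. The boundary of this tuple compares y with `c x z`.
    have hv : G.IsMagnitudeTuple 4 ![x, y, c x z, z] := (isMagnitudeTuple_four_iff hD).2
      ⟨h0 (by omega), h0 (by omega), h0 (by omega), by omega⟩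
    have hK : K x z = T x (c x z) z := by
      by_cases h4 : D x z = 4
      · exact if_pos h4
      · exact (if_neg h4).trans (hT (by omega)).symm
    exact ⟨_, by rw [magnitudeDifferential_four hv, hK]; simp only [T]; abel⟩
  have main : ∀ {x y z}, G.IsMagnitudeTuple 4 ![x, y, z] → T x y z - K x z ∈ R := by
    intro x y z hxyz
    obtain ⟨hxy, hyz, hl⟩ := (isMagnitudeTuple_three_iff hD).1 hxyz
    by_cases h1 : D x y = 1
    · exact near h1 (by omega)
    · have hxy' := h0' hxy
      -- Replace y by the first point w of a geodesic from x to y; the boundary of (x,w,y,z)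
      -- compares the two triples.
      obtain ⟨w, hw1, hw2⟩ := hdesc x y hxy
      have hv : G.IsMagnitudeTuple 4 ![x, w, y, z] := (isMagnitudeTuple_four_iff hD).2
        ⟨h0 (by omega), h0 (by omega), hyz, by omega⟩
      have hw : T x w z - K x z ∈ R := by
        by_cases h3 : D w z = 3
        · exact near hw1 h3
        -- Here d(w,z) < 3, hence d(x,z) < 4, and both terms vanish.
        · have t1 := htri w y z
          have t2 := htri x w z
          have hK : K x z = 0 := if_neg (by omega)
          rw [hT (by omega), hK, sub_zero]
          exact R.zero_mem
      have hb : G.magnitudeDifferential 2 4 (G.tupleOrZero 4 ![x, w, y, z]) ∈ R := ⟨_, rfl⟩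
      have := R.sub_mem hw hb
      rw [magnitudeDifferential_four hv] at this
      convert this using 1
      simp only [T]
      abel
  let s : G.MagnitudeChain 1 4 →ₗ[ℤ] G.MagnitudeChain 2 4 :=
    Finsupp.linearCombination ℤ fun p => -T (p.1 0) (c (p.1 0) (p.1 1)) (p.1 1)
  have hs : ∀ x z, s (G.tupleOrZero 4 ![x, z]) = -K x z := by
    intro x z
    by_cases h4 : D x z = 4
    · rw [tupleOrZero, dif_pos ((isMagnitudeTuple_two_iff hD).2 ⟨h0 (by omega), h4⟩),
        Finsupp.linearCombination_single, one_smul]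
      simp [K, h4]
    · rw [tupleOrZero, dif_neg fun h => h4 ((isMagnitudeTuple_two_iff hD).1 h).2, map_zero]
      simp [K, h4]
  -- A partial contracting homotopy: modulo boundaries, s ∘ ∂ is the identity, so a chain killed by
  -- ∂ is a boundary.
  have hom : R.mkQ ∘ₗ (LinearMap.id - s ∘ₗ G.magnitudeDifferential 1 4) = 0 := by
    refine Finsupp.lhom_ext' fun p => LinearMap.ext_ring ?_
    obtain ⟨p, hp⟩ := p
    obtain ⟨x, y, z, rfl⟩ : ∃ x y z, p = ![x, y, z] :=
      ⟨p 0, p 1, p 2, by ext i; fin_cases i <;> rfl⟩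
    simp only [LinearMap.comp_apply, Finsupp.lsingle_apply, LinearMap.zero_apply,
      LinearMap.sub_apply, LinearMap.id_apply]
    rw [single_eq_tupleOrZero, magnitudeDifferential_three hp, map_neg, hs, neg_neg,
      Submodule.mkQ_apply, Submodule.Quotient.mk_eq_zero]
    exact main hp
  refine G.isZero_magnitudeHomology 1 4 fun a ha => ?_
  have := LinearMap.congr_fun hom a
  simpa [ha, R] using this

/-- Two geodesic interior points lying in different components of an interval give a class of
infinite order in degree two. Here `S` is a union of components of the interval from `x` to `z`. -/
theorem finrank_magnitudeHomology_two_ne_zero [Finite V] (hD : ∀ x y, G.edist x y = D x y)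
    {l : ℕ} (x z : V) (S : Set V)
    (hS : ∀ w y, x ≠ w → w ≠ y → y ≠ z → D x w + D w y + D y z = l →
      (D x y + D y z = l ∧ x ≠ y ∧ y ∈ S ↔ D x w + D w z = l ∧ w ≠ z ∧ w ∈ S))
    (a b : V) (ha : x ≠ a ∧ a ≠ z ∧ D x a + D a z = l) (hb : x ≠ b ∧ b ≠ z ∧ D x b + D b z = l)
    (haS : a ∈ S) (hbS : b ∉ S) :
    Module.finrank ℤ (G.magnitudeHomology 2 l) ≠ 0 := by
  classical
  let φ : G.MagnitudeChain 2 l →ₗ[ℤ] ℤ :=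
    Finsupp.linearCombination ℤ fun p => if p.1 0 = x ∧ p.1 1 ∈ S ∧ p.1 2 = z then 1 else 0
  have hφ : ∀ x' y z', φ (G.tupleOrZero l ![x', y, z']) =
      if G.IsMagnitudeTuple l ![x', y, z'] ∧ x' = x ∧ y ∈ S ∧ z' = z then 1 else 0 := by
    intro x' y z'
    by_cases h : G.IsMagnitudeTuple l ![x', y, z']
    · rw [tupleOrZero, dif_pos h, Finsupp.linearCombination_single, one_smul]
      simp only [h, true_and]
      rfl
    · rw [tupleOrZero, dif_neg h, map_zero, if_neg fun h' => h h'.1]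
  have hcocycle : φ ∘ₗ G.magnitudeDifferential 2 l = 0 := by
    refine Finsupp.lhom_ext' fun p => LinearMap.ext_ring ?_
    obtain ⟨p, hp⟩ := p
    obtain ⟨x', w, y, z', rfl⟩ : ∃ x' w y z', p = ![x', w, y, z'] :=
      ⟨p 0, p 1, p 2, p 3, by ext i; fin_cases i <;> rfl⟩
    simp only [LinearMap.comp_apply, Finsupp.lsingle_apply, LinearMap.zero_apply]
    rw [single_eq_tupleOrZero, magnitudeDifferential_four hp, map_add, map_neg, hφ, hφ,
      neg_add_eq_zero]
    obtain ⟨h1, h2, h3, h4⟩ := (isMagnitudeTuple_four_iff hD).1 hp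
    refine if_congr ?_ rfl rfl
    rw [isMagnitudeTuple_three_iff hD, isMagnitudeTuple_three_iff hD]
    by_cases hx : x' = x
    · by_cases hz : z' = z
      · subst hx hz
        have := hS w y h1 h2 h3 h4
        tauto
      · simp [hz]
    · simp [hx]
  have ha' := (isMagnitudeTuple_three_iff (l := l) hD).2 ha
  have hb' := (isMagnitudeTuple_three_iff (l := l) hD).2 hb
  refine G.finrank_magnitudeHomology_ne_zero 1 l φ (fun d => LinearMap.congr_fun hcocycle d)
    -- Both triples have differential -(x,z), or 0 if d(x,z) ≠ l, so their difference is a cycle.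
    (G.tupleOrZero l ![x, a, z] - G.tupleOrZero l ![x, b, z]) ?_ ?_
  · rw [map_sub, magnitudeDifferential_three ha', magnitudeDifferential_three hb', sub_self]
  · rw [map_sub, hφ, hφ]
    simp [ha', haS, hbS]

end LowDegree
-- The common magnitude
section Magnitude

theorem connected_of_edist_eq {V : Type*} [Nonempty V] {G : SimpleGraph V} {D : V → V → ℕ}
    (hD : ∀ x y, G.edist x y = D x y) : G.Connected where
  preconnected x y := reachable_of_edist_ne_top (by simp [hD])

/-- The magnitude of a connected graph whose distance-generating polynomial from each vertex is
`1 + 3q + 6q² + 6q³ + 3q⁴ + q⁵`. -/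
theorem magnitude_eq_of_distance_multiset {V : Type*} [Fintype V] [Nonempty V]
    {G : SimpleGraph V} {D : V → V → ℕ} (hD : ∀ x y, G.edist x y = D x y)
    (h : ∀ x, Finset.univ.val.map (D x) =
      {0, 1, 1, 1, 2, 2, 2, 2, 2, 2, 3, 3, 3, 3, 3, 3, 4, 4, 4, 5}) :
    G.magnitude = (Fintype.card V : RatFunc ℚ) / (1 + 3 * RatFunc.X + 6 * RatFunc.X ^ 2 + 6 * RatFunc.X ^ 3
          + 3 * RatFunc.X ^ 4 + RatFunc.X ^ 5) := by
  refine G.magnitude_eq_of_sum_eq (connected_of_edist_eq hD) _ ?_ fun x => ?_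
  -- The denominator is nonzero since its constant term is 1.
  · let p : Polynomial ℚ := 1 + 3 * Polynomial.X + 6 * Polynomial.X ^ 2 + 6 * Polynomial.X ^ 3
          + 3 * Polynomial.X ^ 4 + Polynomial.X ^ 5
    have hp : p ≠ 0 := fun h0 => by
      have := congrArg (Polynomial.eval 0) h0
      simp [p] at this
    have := (map_ne_zero_iff _ (RatFunc.algebraMap_injective ℚ)).2 hp
    simpa only [p, map_add, map_mul, map_pow, map_one, map_ofNat, RatFunc.algebraMap_X] using this
  · have hd : ∀ y, G.dist x y = D x y := fun y => by simp [dist, hD]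
    simp only [hd]
    have := congrArg (fun s => (s.map fun n => (RatFunc.X : RatFunc ℚ) ^ n).sum) (h x)
    simp only [Multiset.map_map, Function.comp_def] at this
    refine Eq.trans this ?_
    simp
    ring

theorem dodecahedralDist_multiset : ∀ x, Finset.univ.val.map (dodecahedralDist x) =
    {0, 1, 1, 1, 2, 2, 2, 2, 2, 2, 3, 3, 3, 3, 3, 3, 4, 4, 4, 5} := by
  decide +kernel

theorem desarguesDist_multiset : ∀ x, Finset.univ.val.map (desarguesDist x) =
    {0, 1, 1, 1, 2, 2, 2, 2, 2, 2, 3, 3, 3, 3, 3, 3, 4, 4, 4, 5} := by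
  decide +kernel

end Magnitude

/-! ### `MH_{2,4}` of the two graphs -/

/-- The interior of one of the two geodesics of length four from `u₀` to `u₄`. -/
def dodecahedralGeodesic : Finset (ZMod 10 ⊕ ZMod 10) := {.inl 1, .inl 2, .inl 3}

-- The only geodesics from u₀ to u₄ run through u₁, u₂, u₃ or through v₀, v₂, v₄. Since d(u₀,u₄) =
-- 4, a tuple of length 4 between them follows one geodesic and cannot switch strands.
set_option synthInstance.maxSize 1000 in
theorem mem_dodecahedralGeodesic_iff : ∀ w y : ZMod 10 ⊕ ZMod 10, .inl 0 ≠ w → w ≠ y → y ≠ .inl 4 →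
    dodecahedralDist (.inl 0) w + dodecahedralDist w y + dodecahedralDist y (.inl 4) = 4 →
    (dodecahedralDist (.inl 0) y + dodecahedralDist y (.inl 4) = 4 ∧ .inl 0 ≠ y ∧
        y ∈ dodecahedralGeodesic ↔
      dodecahedralDist (.inl 0) w + dodecahedralDist w (.inl 4) = 4 ∧ w ≠ .inl 4 ∧
        w ∈ dodecahedralGeodesic) := by
  decide +kernel

theorem finrank_magnitudeHomology_dodecahedralGraph :
    Module.finrank ℤ (dodecahedralGraph.magnitudeHomology 2 4) ≠ 0 :=
  finrank_magnitudeHomology_two_ne_zero edist_dodecahedralGraph (.inl 0) (.inl 4)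
    {y | y ∈ dodecahedralGeodesic} mem_dodecahedralGeodesic_iff (.inl 1) (.inr 0)
    (by decide +kernel) (by decide +kernel) (by decide +kernel : .inl 1 ∈ dodecahedralGeodesic)
    (by decide +kernel : .inr 0 ∉ dodecahedralGeodesic)

theorem isZero_magnitudeHomology_desarguesGraph :
    CategoryTheory.Limits.IsZero (desarguesGraph.magnitudeHomology 2 4) := by
  refine isZero_magnitudeHomology_two_four edist_desarguesGraph ?_ desarguesDist_eq_two_or_four
    exists_desarguesDist
  decide +kernel

end SimpleGraph

theorem mainTheorem8 :
    SimpleGraph.dodecahedralGraph.magnitude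
      = 20 / (1 + 3 * RatFunc.X + 6 * RatFunc.X ^ 2 + 6 * RatFunc.X ^ 3
          + 3 * RatFunc.X ^ 4 + RatFunc.X ^ 5) ∧
    SimpleGraph.desarguesGraph.magnitude
      = 20 / (1 + 3 * RatFunc.X + 6 * RatFunc.X ^ 2 + 6 * RatFunc.X ^ 3
          + 3 * RatFunc.X ^ 4 + RatFunc.X ^ 5) ∧
    (¬ ∀ k l : ℕ, Nonempty (SimpleGraph.dodecahedralGraph.magnitudeHomology k l ≅
      SimpleGraph.desarguesGraph.magnitudeHomology k l)) ∧
    Module.finrank ℤ (SimpleGraph.dodecahedralGraph.magnitudeHomology 2 4) ≠ 0 ∧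
    CategoryTheory.Limits.IsZero (SimpleGraph.desarguesGraph.magnitudeHomology 2 4) := by
  have hcard : (Fintype.card (ZMod 10 ⊕ ZMod 10) : RatFunc ℚ) = 20 := by
    simp only [Fintype.card_sum, ZMod.card]
    norm_num
  have hdod := SimpleGraph.finrank_magnitudeHomology_dodecahedralGraph
  have hdes := SimpleGraph.isZero_magnitudeHomology_desarguesGraph
  refine ⟨?_, ?_, fun h => ?_, hdod, hdes⟩
  · rw [SimpleGraph.magnitude_eq_of_distance_multiset SimpleGraph.edist_dodecahedralGraph
      SimpleGraph.dodecahedralDist_multiset, hcard]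
  · rw [SimpleGraph.magnitude_eq_of_distance_multiset SimpleGraph.edist_desarguesGraph
      SimpleGraph.desarguesDist_multiset, hcard]
  · obtain ⟨e⟩ := h 2 4
    have := ModuleCat.subsingleton_of_isZero (hdes.of_iso e)
    exact hdod Module.finrank_zero_of_subsingleton
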